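/- Let $G$ be a finite simple graph. An arc of $G$ is an ordered pair $(u,v)$ of adjacent vertices; its terminus is $v$ and its inverse is $(u,v)^{-1}=(v,u)$. Let $\mathcal A$ be the set of arcs, and define the complex matrices $S\in\mathbb C^{\mathcal A\times\mathcal A}$ by $S_{ab}=\delta_{a,b^{-1}}$, $N\in\mathbb C^{V(G)\times\mathcal A}$ by $N_{ua}=\frac{1}{\sqrt{\deg u}}$ if $u$ is the terminus of $a$ and $N_{ua}=0$ otherwise, and $U=S(2N^*N-I)$, the time evolution matrix of the Grover walk on $G$. For a vertex $u$ let $\Phi_u=N^*\mathbf e_u$, where $\mathbf e_u$ is the unit vector of $u$. The graph $G$ exhibits (Grover) perfect state transfer if there exist distinct vertices $u,v$, a time $\tau\in\mathbb N$ and a complex number $\gamma$ with $|\gamma|=1$ such that $U^\tau\Phi_u=\gamma\Phi_v$. The graph $G$ is distance-regular if it is connected and, for any two vertices $u,v$ and all $i,j$, the number of vertices at distance $i$ from $u$ and at distance $j$ from $v$ depends only on $i$, $j$ and the distance between $u$ and $v$. **Theorem.** Let $G$ be a (finite, simple) distance-regular graph of diameter $3$. Then $G$ exhibits perfect state transfer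 if and only if $G$ is isomorphic to the cycle $C_6$. -/

import Mathlib

open scoped Matrix

noncomputable section

namespace GroverWalk

variable {V : Type*} [Fintype V] [DecidableEq V] (G : SimpleGraph V) [DecidableRel G.Adj]

/-- The shift matrix `S`, indexed by the arcs `(u, v)` (ordered pairs of adjacent vertices) of `G`:
`S a b = 1` if `a` is the inverse arc of `b`, and `0` otherwise. -/
def shift : Matrix G.Dart G.Dart ℂ :=
  Matrix.of fun a b => if a = b.symm then 1 else 0

/-- The boundary matrix `N`: `N u a = 1 / √(deg u)` if `u` is the terminus of the arc `a`,
and `0` otherwise. -/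
def boundary : Matrix V G.Dart ℂ :=
  Matrix.of fun u a => if u = a.snd then 1 / ((Real.sqrt (G.degree u) : ℝ) : ℂ) else 0

/-- The coin matrix `K = 2 N* N - I`. -/
def coin : Matrix G.Dart G.Dart ℂ :=
  (2 : ℂ) • ((boundary G)ᴴ * boundary G) - 1

/-- The time evolution matrix `U = S K` of the Grover walk on `G`. -/
def evolution : Matrix G.Dart G.Dart ℂ :=
  shift G * coin G

/-- The vertex-type state `Φ_u = N* e_u`. -/
def vertexState (u : V) : G.Dart → ℂ :=
  (boundary G)ᴴ *ᵥ Pi.single u 1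

/-- Perfect state transfer from the vertex `u` to another vertex `v` at time `τ`:
`U ^ τ Φ_u = γ Φ_v` for some unimodular complex number `γ`. -/
def PSTFromTo (u v : V) (τ : ℕ) : Prop :=
  u ≠ v ∧ ∃ γ : ℂ, ‖γ‖ = 1 ∧ (evolution G ^ τ) *ᵥ vertexState G u = γ • vertexState G v

/-- `G` exhibits perfect state transfer: it occurs between some two distinct vertices at some
time. -/
def ExhibitsPST : Prop :=
  ∃ (u v : V) (τ : ℕ), PSTFromTo G u v τ

/-- `G` is distance-regular: it is connected, and for any two vertices `u` and `v` the number of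
vertices at distance `i` from `u` and distance `j` from `v` depends only on `i`, `j` and the
distance between `u` and `v`. -/
def IsDistanceRegular {V : Type*} [Fintype V] (G : SimpleGraph V) : Prop :=
  G.Connected ∧ ∀ (i j : ℕ) (u v u' v' : V), G.dist u v = G.dist u' v' →
    (Finset.univ.filter fun w => G.dist u w = i ∧ G.dist v w = j).card =
      (Finset.univ.filter fun w => G.dist u' w = i ∧ G.dist v' w = j).card

end GroverWalk

end

/-! On a `k`-regular graph, summing the walk over the arcs entering each vertex turns `U ^ n Φ_u`
into `T_n(A / k) e_u`, with `A` the adjacency matrix and `T_n` the Chebyshev polynomial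
(`amplitude_add_two`). If `G` is distance-regular, this vector depends only on the distance from
`u`; transfer to `v` makes it a nonzero multiple of `e_v`, so `v` is alone at its distance from `u`
(`eq_of_pst`). In diameter three that distance must be three (`dist_eq_three`), and every other
vertex is then adjacent to exactly one of `u`, `v`.

Hence the vector equal to `k` on `u`, `v` and `-1` elsewhere is an eigenvector of `A` for `-1`.
Pairing it and the constant vector with the amplitudes gives `cos (τ θ) = 1` where `cos θ = -1 / k`.
Niven's theorem forces `k = 2`, and the graph is a hexagon. Conversely, on a cycle the walk carries
each arc straight ahead, so in `C_6` the state `Φ_u` reaches the antipode after three steps. -/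

namespace GroverWalk

/-! ### The walk on a regular graph and its Chebyshev recurrence -/

section Walk

variable {V : Type*} [Fintype V] [DecidableEq V] (G : SimpleGraph V) [DecidableRel G.Adj]

/-- A sum over the arcs with terminus `w` of a function of the origin is a sum over neighbors. -/
theorem sum_darts_snd_eq (w : V) (φ : V → ℂ) :
    ∑ a : G.Dart with a.snd = w, φ a.fst = ∑ z ∈ G.neighborFinset w, φ z := by
  refine Finset.sum_bij (fun a _ => a.fst) ?_ ?_ ?_ ?_
  · intro a ha
    obtain rfl := (Finset.mem_filter.1 ha).2
    simpa using a.adj.symm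
  · intro a ha b hb hab
    have h1 := (Finset.mem_filter.1 ha).2
    have h2 := (Finset.mem_filter.1 hb).2
    exact SimpleGraph.Dart.ext _ _ (Prod.ext hab (h1.trans h2.symm))
  · intro z hz
    refine ⟨⟨(z, w), ((G.mem_neighborFinset w z).1 hz).symm⟩, by simp, rfl⟩
  · intro a _
    rfl

theorem sum_darts_fst_eq_symm (w : V) (x : G.Dart → ℂ) :
    ∑ a : G.Dart with a.fst = w, x a = ∑ a : G.Dart with a.snd = w, x a.symm := by
  refine Finset.sum_bij' (fun a _ => a.symm) (fun a _ => a.symm) ?_ ?_ ?_ ?_ ?_ <;>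
    simp

theorem sum_darts_snd_eq_symm (w : V) (x : G.Dart → ℂ) :
    ∑ a : G.Dart with a.snd = w, x a = ∑ a : G.Dart with a.fst = w, x a.symm := by
  simp [sum_darts_fst_eq_symm]

theorem boundary_conjTranspose_apply (a : G.Dart) (u : V) :
    (boundary G)ᴴ a u = if u = a.snd then 1 / ((Real.sqrt (G.degree u) : ℝ) : ℂ) else 0 := by
  rw [Matrix.conjTranspose_apply, boundary, Matrix.of_apply]
  split_ifs <;> simp

theorem vertexState_apply (u : V) (a : G.Dart) :
    vertexState G u a = if a.snd = u then 1 / ((Real.sqrt (G.degree u) : ℝ) : ℂ) else 0 := by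
  rw [vertexState, Matrix.mulVec_single_one, Matrix.col_apply, boundary_conjTranspose_apply]
  simp [eq_comm]

theorem evolution_mulVec_apply (x : G.Dart → ℂ) (a : G.Dart) :
    (evolution G *ᵥ x) a =
      2 / (G.degree a.fst : ℂ) * ∑ b : G.Dart with b.snd = a.fst, x b - x a.symm := by
  have hS : ∀ y : G.Dart → ℂ, (shift G *ᵥ y) a = y a.symm := by
    intro y
    simp only [shift, Matrix.mulVec, dotProduct, Matrix.of_apply]
    rw [Finset.sum_eq_single a.symm]
    · simp
    · intro b _ hb
      rw [if_neg, zero_mul]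
      rintro rfl
      simp at hb
    · simp
  have hsq : ((Real.sqrt (G.degree a.fst) : ℝ) : ℂ) * ((Real.sqrt (G.degree a.fst) : ℝ) : ℂ)
      = (G.degree a.fst : ℂ) := by
    rw [← Complex.ofReal_mul, Real.mul_self_sqrt (by positivity)]
    simp
  rw [evolution, ← Matrix.mulVec_mulVec, hS, coin, Matrix.sub_mulVec, Matrix.one_mulVec,
    Matrix.smul_mulVec, ← Matrix.mulVec_mulVec]
  simp only [Pi.sub_apply, Pi.smul_apply, smul_eq_mul]
  congr 1
  have hN : (boundary G *ᵥ x) a.fst =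
      1 / ((Real.sqrt (G.degree a.fst) : ℝ) : ℂ) * ∑ b : G.Dart with b.snd = a.fst, x b := by
    simp only [Matrix.mulVec, dotProduct, boundary, Matrix.of_apply, Finset.sum_filter,
      Finset.mul_sum]
    refine Finset.sum_congr rfl fun b _ => ?_
    by_cases h : a.fst = b.snd
    · simp [h]
    · simp [h, Ne.symm h]
  have hNs : ((boundary G)ᴴ *ᵥ (boundary G *ᵥ x)) a.symm =
      1 / ((Real.sqrt (G.degree a.fst) : ℝ) : ℂ) * (boundary G *ᵥ x) a.fst := by
    rw [Matrix.mulVec, dotProduct, Finset.sum_eq_single a.fst]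
    · rw [boundary_conjTranspose_apply]
      simp
    · intro b _ hb
      rw [boundary_conjTranspose_apply]
      simp [hb]
    · simp
  rw [hNs, hN, ← hsq]
  ring

/-- The total amplitude on the arcs ending at `w` after `n` steps of the walk started at `Φ_u`,
normalised to be the indicator of `u` at time `0`. -/
noncomputable def amplitude (u : V) (n : ℕ) (w : V) : ℂ :=
  1 / ((Real.sqrt (G.degree w) : ℝ) : ℂ) *
    ∑ a : G.Dart with a.snd = w, ((evolution G ^ n) *ᵥ vertexState G u) a

variable {G} {k : ℕ}

theorem sqrt_natCast_mul_self (k : ℕ) :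
    ((Real.sqrt k : ℝ) : ℂ) * ((Real.sqrt k : ℝ) : ℂ) = k := by
  rw [← Complex.ofReal_mul, Real.mul_self_sqrt (by positivity)]
  simp

theorem sqrt_natCast_ne_zero (hk : k ≠ 0) : ((Real.sqrt k : ℝ) : ℂ) ≠ 0 := by
  intro h
  have := sqrt_natCast_mul_self k
  rw [h, mul_zero] at this
  exact hk (by exact_mod_cast this.symm)

theorem sum_vertexState (hreg : G.IsRegularOfDegree k) (hk : k ≠ 0) (v w : V) :
    1 / ((Real.sqrt (G.degree w) : ℝ) : ℂ) * ∑ a : G.Dart with a.snd = w, vertexState G v a =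
      if w = v then 1 else 0 := by
  have h : ∀ a ∈ ({a : G.Dart | a.snd = w} : Finset G.Dart), vertexState G v a =
      (fun _ : V => if w = v then 1 / ((Real.sqrt k : ℝ) : ℂ) else 0) a.fst := by
    intro a ha
    rw [vertexState_apply, hreg v, (Finset.mem_filter.1 ha).2]
  rw [Finset.sum_congr rfl h,
    sum_darts_snd_eq G w (fun _ => if w = v then 1 / ((Real.sqrt k : ℝ) : ℂ) else 0),
    Finset.sum_const,
    SimpleGraph.card_neighborFinset_eq_degree, hreg w]
  split_ifs
  · have h2 := sqrt_natCast_ne_zero hk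
    rw [nsmul_eq_mul, ← sqrt_natCast_mul_self k]
    field_simp
  · simp

theorem amplitude_zero (hreg : G.IsRegularOfDegree k) (hk : k ≠ 0) (u w : V) :
    amplitude G u 0 w = if w = u then 1 else 0 := by
  simp only [amplitude, pow_zero, Matrix.one_mulVec]
  exact sum_vertexState hreg hk u w

/-- At each vertex of positive degree the coin is a reflection fixing the constant vector, so it
preserves the sum over incoming arcs; the shift then reverses these arcs. -/
theorem sum_evolution_fst (hk : k ≠ 0) (hreg : G.IsRegularOfDegree k) (x : G.Dart → ℂ) (w : V) :
    ∑ a : G.Dart with a.fst = w, (evolution G *ᵥ x) a = ∑ a : G.Dart with a.snd = w, x a := by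
  have hk' : (k : ℂ) ≠ 0 := by exact_mod_cast hk
  have h : ∀ a ∈ ({a : G.Dart | a.fst = w} : Finset G.Dart), (evolution G *ᵥ x) a =
      2 / (k : ℂ) * (∑ b : G.Dart with b.snd = w, x b) - x a.symm := by
    intro a ha
    rw [evolution_mulVec_apply, (Finset.mem_filter.1 ha).2, hreg w]
  rw [Finset.sum_congr rfl h, Finset.sum_sub_distrib, ← sum_darts_snd_eq_symm,
    Finset.sum_const, SimpleGraph.dart_fst_fiber_card_eq_degree, hreg w, nsmul_eq_mul]
  field_simp
  ring

theorem sum_evolution_snd (hreg : G.IsRegularOfDegree k) (x : G.Dart → ℂ) (w : V) :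
    ∑ a : G.Dart with a.snd = w, (evolution G *ᵥ x) a =
      2 / (k : ℂ) * (∑ z ∈ G.neighborFinset w, ∑ b : G.Dart with b.snd = z, x b) -
        ∑ a : G.Dart with a.fst = w, x a := by
  simp only [evolution_mulVec_apply, hreg _]
  rw [Finset.sum_sub_distrib, ← sum_darts_fst_eq_symm, ← Finset.mul_sum,
    sum_darts_snd_eq G w fun z => ∑ b : G.Dart with b.snd = z, x b]

theorem amplitude_one (hreg : G.IsRegularOfDegree k) (hk : k ≠ 0) (u w : V) :
    amplitude G u 1 w = 1 / (k : ℂ) * ∑ z ∈ G.neighborFinset w, amplitude G u 0 z := by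
  have hk' : (k : ℂ) ≠ 0 := by exact_mod_cast hk
  have h2 := sqrt_natCast_ne_zero hk
  have h : ∀ a ∈ ({a : G.Dart | a.snd = w} : Finset G.Dart), vertexState G u a.symm =
      (fun z : V => if z = u then 1 / ((Real.sqrt k : ℝ) : ℂ) else 0) a.fst := by
    intro a _
    rw [vertexState_apply, hreg u]
    rfl
  have h0 : ∑ a : G.Dart with a.fst = w, vertexState G u a =
      1 / ((Real.sqrt k : ℝ) : ℂ) * ∑ z ∈ G.neighborFinset w, if z = u then 1 else 0 := by
    rw [sum_darts_fst_eq_symm, Finset.sum_congr rfl h,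
      sum_darts_snd_eq G w (fun z : V => if z = u then 1 / ((Real.sqrt k : ℝ) : ℂ) else 0),
      Finset.mul_sum]
    simp
  have h1 : ∀ z, ∑ b : G.Dart with b.snd = z, vertexState G u b =
      ((Real.sqrt k : ℝ) : ℂ) * if z = u then 1 else 0 := by
    intro z
    rw [← sum_vertexState hreg hk u z, hreg z]
    field_simp
  simp only [amplitude_zero hreg hk]
  rw [amplitude, pow_one, sum_evolution_snd hreg, h0, hreg w]
  simp only [h1]
  rw [← Finset.mul_sum, ← sqrt_natCast_mul_self k]
  field_simp
  ring

/-- This is `T_{n+2} = 2 x T_{n+1} - T_n` at `x = A / k`. The outgoing sum subtracted at the last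
step is the incoming sum one step earlier, by `sum_evolution_fst`. -/
theorem amplitude_add_two (hreg : G.IsRegularOfDegree k) (hk : k ≠ 0) (u w : V) (n : ℕ) :
    amplitude G u (n + 2) w =
      2 / (k : ℂ) * (∑ z ∈ G.neighborFinset w, amplitude G u (n + 1) z) - amplitude G u n w := by
  simp only [amplitude, hreg _, ← Finset.mul_sum]
  rw [pow_succ' _ (n + 1), ← Matrix.mulVec_mulVec, sum_evolution_snd hreg]
  rw [pow_succ' _ n, ← Matrix.mulVec_mulVec, sum_evolution_fst hk hreg]
  ring

/-- Passing to vertex sums loses information, but this is all that is needed from the transfer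
equation. -/
theorem PSTFromTo.amplitude_eq (hreg : G.IsRegularOfDegree k) (hk : k ≠ 0) {u v : V} {τ : ℕ}
    (h : PSTFromTo G u v τ) :
    ∃ γ : ℂ, γ ≠ 0 ∧ ∀ w, amplitude G u τ w = if w = v then γ else 0 := by
  obtain ⟨-, γ, hγ, h⟩ := h
  refine ⟨γ, fun h0 => by simp [h0] at hγ, fun w => ?_⟩
  have := sum_vertexState hreg hk v w
  rw [amplitude, h]
  simp only [Pi.smul_apply, smul_eq_mul]
  rw [← Finset.mul_sum, mul_left_comm, this]
  simp

theorem PSTFromTo.time_ne_zero (hreg : G.IsRegularOfDegree k) (hk : k ≠ 0) {u v : V} {τ : ℕ}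
    (h : PSTFromTo G u v τ) : τ ≠ 0 := by
  rintro rfl
  obtain ⟨γ, hγ, h'⟩ := h.amplitude_eq hreg hk
  have := h' v
  rw [amplitude_zero hreg hk, if_neg h.1.symm, if_pos rfl] at this
  exact hγ this.symm

/-- Pairing the amplitudes with an eigenvector of the adjacency matrix for the eigenvalue `k cos θ`
gives Chebyshev values. -/
theorem sum_mul_amplitude (hreg : G.IsRegularOfDegree k) (hk : k ≠ 0) (u : V) (y : V → ℂ) (θ : ℝ)
    (hy : ∀ w, ∑ z ∈ G.neighborFinset w, y z = k * Real.cos θ * y w) (n : ℕ) :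
    ∑ w, y w * amplitude G u n w = Real.cos (n * θ) * y u := by
  have hk' : (k : ℂ) ≠ 0 := by exact_mod_cast hk
  -- The adjacency operator is symmetric, so it can be moved from `f` onto the eigenvector `y`.
  have key : ∀ f : V → ℂ, ∑ w, y w * ∑ z ∈ G.neighborFinset w, f z =
      k * Real.cos θ * ∑ w, y w * f w := by
    intro f
    simp only [Finset.mul_sum]
    rw [Finset.sum_comm' (t' := Finset.univ) (s' := fun z => G.neighborFinset z)
      (by simp [SimpleGraph.adj_comm])]
    refine Finset.sum_congr rfl fun z _ => ?_
    rw [← Finset.sum_mul, hy]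
    ring
  induction n using Nat.twoStepInduction with
  | zero => simp [amplitude_zero hreg hk]
  | one =>
    simp only [amplitude_one hreg hk, mul_left_comm (y _)]
    rw [← Finset.mul_sum, key]
    simp only [amplitude_zero hreg hk]
    simp
    field_simp
  | more n ih1 ih2 =>
    simp only [amplitude_add_two hreg hk, mul_sub, mul_left_comm (y _) (2 / (k : ℂ))]
    rw [Finset.sum_sub_distrib, ← Finset.mul_sum, key, ih1, ih2]
    have : Real.cos ((n + 2 : ℕ) * θ) =
        2 * Real.cos θ * Real.cos ((n + 1 : ℕ) * θ) - Real.cos (n * θ) := by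
      have h1 : ((n + 2 : ℕ) : ℝ) * θ = (n + 1 : ℕ) * θ + θ := by push_cast; ring
      have h2 : (n : ℝ) * θ = (n + 1 : ℕ) * θ - θ := by push_cast; ring
      rw [h1, h2, Real.cos_add, Real.cos_sub]
      ring
    rw [this]
    push_cast
    field_simp

end Walk

end GroverWalk

/-! ### Distance-regular graphs of diameter three -/

namespace GroverWalk

theorem exists_geodesic_of_dist_eq_three {V : Type*} {G : SimpleGraph V} {s t : V} (h : G.dist s t = 3) :
    ∃ x y, G.Adj s x ∧ G.Adj x y ∧ G.Adj y t ∧ G.dist s x = 1 ∧ G.dist s y = 2 := by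
  have hr : G.Reachable s t := SimpleGraph.Reachable.of_dist_ne_zero (by omega)
  obtain ⟨p, hp⟩ := hr.exists_walk_length_eq_dist
  rw [h] at hp
  match p, hp with
  | .cons (v := x) hsx (.cons (v := y) hxy (.cons hyt .nil)), _ =>
    refine ⟨x, y, hsx, hxy, hyt, SimpleGraph.dist_eq_one_iff_adj.2 hsx, ?_⟩
    have h1 := SimpleGraph.dist_le (SimpleGraph.Walk.cons hsx (SimpleGraph.Walk.cons hxy .nil))
    have h2 := (hsx.reachable.trans hxy.reachable).dist_triangle_left t
    rw [h, SimpleGraph.dist_eq_one_iff_adj.2 hyt] at h2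
    simp only [SimpleGraph.Walk.length_cons, SimpleGraph.Walk.length_nil] at h1
    omega

section DistanceRegular

variable {V : Type*} [Fintype V] {G : SimpleGraph V}

theorem IsDistanceRegular.exists_dist (hG : IsDistanceRegular G) {u v u' v' : V}
    (h : G.dist u v = G.dist u' v') {i j : ℕ} (w : V) (hi : G.dist u w = i) (hj : G.dist v w = j) :
    ∃ w', G.dist u' w' = i ∧ G.dist v' w' = j := by
  have h1 : 0 < (Finset.univ.filter fun w => G.dist u' w = i ∧ G.dist v' w = j).card := by
    rw [← hG.2 i j u v u' v' h]
    exact Finset.card_pos.2 ⟨w, by simp [hi, hj]⟩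
  obtain ⟨w', hw'⟩ := Finset.card_pos.1 h1
  exact ⟨w', by simpa using hw'⟩

/-- The existence of a neighbor at a given distance from `u` depends only on the distance
to `u`. -/
theorem IsDistanceRegular.exists_adj (hG : IsDistanceRegular G) {u w u' w' : V}
    (h : G.dist u w = G.dist u' w') {i : ℕ} (x : V) (hi : G.dist u x = i) (hx : G.Adj w x) :
    ∃ x', G.dist u' x' = i ∧ G.Adj w' x' := by
  obtain ⟨x', h1, h2⟩ := hG.exists_dist h x hi (SimpleGraph.dist_eq_one_iff_adj.2 hx)
  exact ⟨x', h1, SimpleGraph.dist_eq_one_iff_adj.1 h2⟩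

theorem IsDistanceRegular.card_sphere (hG : IsDistanceRegular G) (i : ℕ) (u u' : V) :
    (Finset.univ.filter fun w => G.dist u w = i).card =
      (Finset.univ.filter fun w => G.dist u' w = i).card := by
  simpa using hG.2 i i u u u' u' (by simp)

/-- Sphere sizes do not depend on the centre, so one singleton sphere makes all spheres of that
radius singletons. -/
theorem IsDistanceRegular.eq_of_dist_eq (hG : IsDistanceRegular G) {u v : V}
    (huv : ∀ w, G.dist u w = G.dist u v → w = v) {s x y : V}
    (hx : G.dist s x = G.dist u v) (hy : G.dist s y = G.dist u v) : x = y := by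
  have h : (Finset.univ.filter fun w => G.dist s w = G.dist u v).card ≤ 1 := by
    rw [hG.card_sphere _ s u, Finset.card_le_one]
    intro a ha b hb
    rw [huv a (by simpa using ha), huv b (by simpa using hb)]
  exact Finset.card_le_one.1 h x (by simpa using hx) y (by simpa using hy)

/-- An antipodal pair at distance three: every other vertex is adjacent to exactly one of both. -/
theorem IsDistanceRegular.adj_iff_not_adj (hG : IsDistanceRegular G) (hle : ∀ x y, G.dist x y ≤ 3)
    {u v : V} (hd : G.dist u v = 3) (huv : ∀ w, G.dist u w = 3 → w = v) {w : V}
    (hwu : w ≠ u) (hwv : w ≠ v) : G.Adj w v ↔ ¬ G.Adj w u := by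
  obtain ⟨x, y, hux, hxy, hyv, h1, h2⟩ := exists_geodesic_of_dist_eq_three hd
  have h0 : 0 < G.dist u w := hG.1.pos_dist_of_ne hwu.symm
  have h3 := hle u w
  have h4 : G.dist u w ≠ 3 := fun h => hwv (huv w h)
  have htri := hG.1.dist_triangle (u := u) (v := w) (w := v)
  constructor
  · intro hwv' hwu'
    rw [SimpleGraph.dist_eq_one_iff_adj.2 hwv', SimpleGraph.dist_eq_one_iff_adj.2 hwu'.symm] at htri
    omega
  · intro hwu'
    have h5 : G.dist u w = 2 := by
      have : G.dist u w ≠ 1 := fun h => hwu' (SimpleGraph.dist_eq_one_iff_adj.1 h).symm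
      omega
    obtain ⟨v', hv', hadj⟩ := hG.exists_adj (h2.trans h5.symm) v hd hyv
    rwa [← huv v' hv']

variable [DecidableRel G.Adj]

theorem IsDistanceRegular.isRegularOfDegree (hG : IsDistanceRegular G) :
    ∃ k, G.IsRegularOfDegree k := by
  obtain ⟨u⟩ := hG.1.nonempty
  have h : ∀ v, G.degree v = (Finset.univ.filter fun w => G.dist v w = 1).card := by
    intro v
    rw [← SimpleGraph.card_neighborFinset_eq_degree]
    congr 1
    ext w
    simp [SimpleGraph.dist_eq_one_iff_adj]
  exact ⟨G.degree u, fun v => by rw [h, h, hG.card_sphere]⟩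

theorem IsDistanceRegular.sum_neighborFinset_eq (hG : IsDistanceRegular G) (u : V) (f : V → ℂ)
    (hf : ∀ w w', G.dist u w = G.dist u w' → f w = f w') (w w' : V)
    (h : G.dist u w = G.dist u w') :
    ∑ z ∈ G.neighborFinset w, f z = ∑ z ∈ G.neighborFinset w', f z := by
  classical
  -- Grouping the neighbors by their distance from `u` exposes the intersection numbers. Summing
  -- over all `v`, weighted by the inverse size of its sphere, avoids choosing a representative of
  -- each sphere.
  have key : ∀ w, ∑ z ∈ G.neighborFinset w, f z =
      ∑ v : V, ((Finset.univ.filter fun z => G.dist u z = G.dist u v ∧ G.dist w z = 1).card : ℂ)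
        * ((Finset.univ.filter fun z => G.dist u z = G.dist u v).card : ℂ)⁻¹ * f v := by
    intro w
    have h1 : ∀ z ∈ G.neighborFinset w, f z =
        ∑ v : V, if G.dist u z = G.dist u v then
          ((Finset.univ.filter fun z => G.dist u z = G.dist u v).card : ℂ)⁻¹ * f v else 0 := by
      intro z _
      have h2 : ∀ v ∈ (Finset.univ : Finset V), (if G.dist u z = G.dist u v then
          ((Finset.univ.filter fun z => G.dist u z = G.dist u v).card : ℂ)⁻¹ * f v else 0) =
          if G.dist u v = G.dist u z then
          ((Finset.univ.filter fun v => G.dist u v = G.dist u z).card : ℂ)⁻¹ * f z else 0 := by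
        intro v _
        by_cases h3 : G.dist u z = G.dist u v
        · simp only [h3, if_true]
          rw [hf z v h3]
        · rw [if_neg h3, if_neg (Ne.symm h3)]
      rw [Finset.sum_congr rfl h2, ← Finset.sum_filter, Finset.sum_const, nsmul_eq_mul,
        mul_inv_cancel_left₀]
      have : 0 < (Finset.univ.filter fun v => G.dist u v = G.dist u z).card :=
        Finset.card_pos.2 ⟨z, by simp⟩
      exact_mod_cast this.ne'
    rw [Finset.sum_congr rfl h1, Finset.sum_comm]
    refine Finset.sum_congr rfl fun v _ => ?_
    rw [← Finset.sum_filter, Finset.sum_const, nsmul_eq_mul, ← mul_assoc]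
    congr 4
    ext z
    simp [SimpleGraph.dist_eq_one_iff_adj, and_comm]
  rw [key, key]
  refine Finset.sum_congr rfl fun v _ => ?_
  rw [hG.2 (G.dist u v) 1 u w u w' h]

theorem IsDistanceRegular.amplitude_eq_of_dist_eq [DecidableEq V] (hG : IsDistanceRegular G) {k : ℕ}
    (hreg : G.IsRegularOfDegree k) (hk : k ≠ 0) (u : V) (n : ℕ) :
    ∀ w w', G.dist u w = G.dist u w' → amplitude G u n w = amplitude G u n w' := by
  have h0 : ∀ w w', G.dist u w = G.dist u w' → amplitude G u 0 w = amplitude G u 0 w' := by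
    intro w w' h
    have : w = u ↔ w' = u := by
      rw [eq_comm, ← hG.1.dist_eq_zero_iff, h, hG.1.dist_eq_zero_iff, eq_comm]
    simp only [amplitude_zero hreg hk, this]
  induction n using Nat.twoStepInduction with
  | zero => exact h0
  | one =>
    intro w w' h
    rw [amplitude_one hreg hk, amplitude_one hreg hk, hG.sum_neighborFinset_eq u _ h0 w w' h]
  | more n ih1 ih2 =>
    intro w w' h
    rw [amplitude_add_two hreg hk, amplitude_add_two hreg hk,
      hG.sum_neighborFinset_eq u _ ih2 w w' h, ih1 w w' h]

/-- In a distance-regular graph with perfect state transfer from `u` to `v`, the vertex `v` is the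
only one at its distance from `u`. -/
theorem IsDistanceRegular.eq_of_pst [DecidableEq V] (hG : IsDistanceRegular G) {k : ℕ}
    (hreg : G.IsRegularOfDegree k) (hk : k ≠ 0) {u v : V} {τ : ℕ} (h : PSTFromTo G u v τ) (w : V)
    (hw : G.dist u w = G.dist u v) : w = v := by
  obtain ⟨γ, hγ, h'⟩ := h.amplitude_eq hreg hk
  by_contra hne
  have := hG.amplitude_eq_of_dist_eq hreg hk u τ w v hw
  rw [h', h', if_neg hne, if_pos rfl] at this
  exact hγ this.symm

/-- An inner vertex of a geodesic has its predecessor and its successor as distinct neighbors. -/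
theorem two_le_degree {k : ℕ} (hreg : G.IsRegularOfDegree k) {s t : V} (h : G.dist s t = 3) :
    2 ≤ k := by
  classical
  obtain ⟨x, y, hsx, hxy, -, -, h2⟩ := exists_geodesic_of_dist_eq_three h
  have hsy : s ≠ y := by rintro rfl; simp at h2
  rw [← hreg x, ← SimpleGraph.card_neighborFinset_eq_degree, ← Finset.card_pair hsy]
  refine Finset.card_le_card ?_
  intro z hz
  rcases Finset.mem_insert.1 hz with rfl | hz
  · simpa using hsx.symm
  · rw [Finset.mem_singleton] at hz
    subst hz
    simpa using hxy

/-- A vertex that is alone at its distance from another vertex is at distance three in a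
distance-regular graph of diameter three. -/
theorem IsDistanceRegular.dist_eq_three (hG : IsDistanceRegular G) (hle : ∀ x y, G.dist x y ≤ 3)
    {s t : V} (hst : G.dist s t = 3) {u v : V} (hne : u ≠ v)
    (huv : ∀ w, G.dist u w = G.dist u v → w = v) : G.dist u v = 3 := by
  classical
  obtain ⟨k, hreg⟩ := hG.isRegularOfDegree
  have h0 : 0 < G.dist u v := hG.1.pos_dist_of_ne hne
  obtain ⟨x, y, hsx, hxy, hyt, h1, h2⟩ := exists_geodesic_of_dist_eq_three hst
  have h3 := hle u v
  have key : ∀ {a b c}, G.dist a b = G.dist u v → G.dist a c = G.dist u v → b = c :=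
    fun hb hc => hG.eq_of_dist_eq huv hb hc
  interval_cases hd : G.dist u v
  -- Distance one: `s` and `y` are both neighbors of `x`, so they would coincide.
  · have := key (a := x) (b := s) (c := y) (SimpleGraph.dist_eq_one_iff_adj.2 hsx.symm)
      (SimpleGraph.dist_eq_one_iff_adj.2 hxy)
    subst this
    simp at h2
  · exfalso
    -- Distance two: `y` is the only vertex at distance two from `s`, so every neighbor of `s` is
    -- adjacent to `y`. Together with `t` this gives `y` at least `k + 1` neighbors.
    have hsub : insert t (G.neighborFinset s) ⊆ G.neighborFinset y := by
      intro z hz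
      rw [SimpleGraph.mem_neighborFinset]
      rcases Finset.mem_insert.1 hz with rfl | hz
      · exact hyt
      · rw [SimpleGraph.mem_neighborFinset] at hz
        obtain ⟨y', hy', hzy⟩ := hG.exists_adj (u := s) (u' := s) (w' := z)
          (h1.trans (SimpleGraph.dist_eq_one_iff_adj.2 hz).symm) y h2 hxy
        rw [key h2 hy']
        exact hzy.symm
    have hcard := Finset.card_le_card hsub
    rw [Finset.card_insert_of_notMem, SimpleGraph.card_neighborFinset_eq_degree,
      SimpleGraph.card_neighborFinset_eq_degree, hreg, hreg] at hcard
    · omega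
    · rw [SimpleGraph.mem_neighborFinset]
      intro hadj
      rw [SimpleGraph.dist_eq_one_iff_adj.2 hadj] at hst
      omega
  · rfl

end DistanceRegular

/-- Here `θ` is a rational multiple of `π` with rational cosine, so by Niven the cosine is `0`,
`±1/2` or `±1`; only `-1/2` has the form `-1 / k` with `k ≥ 2`. -/
theorem eq_two_of_cos_eq {k τ : ℕ} (hk : 2 ≤ k) (hτ : τ ≠ 0) {θ : ℝ}
    (hθ : Real.cos θ = -1 / k) (h : Real.cos (τ * θ) = 1) : k = 2 := by
  obtain ⟨n, hn⟩ := (Real.cos_eq_one_iff _).1 h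
  have hτ' : (τ : ℝ) ≠ 0 := by exact_mod_cast hτ
  have hk' : (2 : ℝ) ≤ k := by exact_mod_cast hk
  have hk0 : (0 : ℝ) < k := by linarith
  have := niven (θ := θ) ⟨2 * n / τ, by push_cast; field_simp; linarith⟩
    ⟨-1 / k, by rw [hθ]; push_cast; rfl⟩
  rw [hθ] at this
  simp only [Set.mem_insert_iff, Set.mem_singleton_iff] at this
  rcases this with h | h | h | h | h <;> field_simp at h
  · linarith
  · exact_mod_cast (by linarith : (k : ℝ) = 2)
  · linarith
  · linarith
  · linarith

/-! ### The antipodal eigenvector -/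

section Forward

variable {V : Type*} [Fintype V] [DecidableEq V] {G : SimpleGraph V} [DecidableRel G.Adj]

/-- At `u` or `v` all `k` neighbors carry `-1`; at any other vertex one neighbor carries `k` and the
remaining `k - 1` carry `-1`, with total `1`. -/
theorem sum_neighborFinset_antipodal {k : ℕ} (hreg : G.IsRegularOfDegree k) {u v : V} (hne : u ≠ v)
    (huv : ¬ G.Adj u v) (hadj : ∀ w, w ≠ u → w ≠ v → (G.Adj w v ↔ ¬ G.Adj w u)) (w : V) :
    ∑ z ∈ G.neighborFinset w, ((if z = u ∨ z = v then (k : ℂ) else -1)) =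
      -(if w = u ∨ w = v then (k : ℂ) else -1) := by
  have h1 : ∀ z ∈ G.neighborFinset w, (if z = u ∨ z = v then (k : ℂ) else -1) =
      (if z = u then (k + 1 : ℂ) else 0) + (if z = v then (k + 1 : ℂ) else 0) - 1 := by
    intro z _
    by_cases h : z = u
    · simp [h, hne]
    · by_cases h' : z = v <;> simp [h, h', hne.symm]
  rw [Finset.sum_congr rfl h1, Finset.sum_sub_distrib, Finset.sum_add_distrib,
    Finset.sum_ite_eq', Finset.sum_ite_eq', Finset.sum_const,
    SimpleGraph.card_neighborFinset_eq_degree, hreg w]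
  simp only [SimpleGraph.mem_neighborFinset]
  by_cases h : w = u
  · subst h
    simp [huv]
  · by_cases h' : w = v
    · subst h'
      have : ¬ G.Adj w u := fun hh => huv hh.symm
      simp [h, this]
    · have := hadj w h h'
      by_cases hA : G.Adj w u <;> simp [h, h', hA, this]

theorem degree_eq_two_of_pst_antipodal {k : ℕ} (hreg : G.IsRegularOfDegree k) (hk : 2 ≤ k)
    {u v : V} {τ : ℕ} (h : PSTFromTo G u v τ) (huv : ¬ G.Adj u v)
    (hadj : ∀ w, w ≠ u → w ≠ v → (G.Adj w v ↔ ¬ G.Adj w u)) : k = 2 := by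
  have hk0 : k ≠ 0 := by omega
  have hk' : (k : ℂ) ≠ 0 := by exact_mod_cast hk0
  have hk2 : (2 : ℝ) ≤ k := by exact_mod_cast hk
  obtain ⟨γ, -, h'⟩ := h.amplitude_eq hreg hk0
  -- The constant vector is an eigenvector for `k = k cos 0`.
  have hγ : γ = 1 := by
    have := sum_mul_amplitude hreg hk0 u (fun _ => 1) 0 (by simp [hreg _]) τ
    simpa [h'] using this
  have hθ : Real.cos (Real.arccos (-1 / k)) = -1 / k := by
    rw [Real.cos_arccos]
    · rw [le_div_iff₀ (by linarith)]; linarith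
    · rw [div_le_iff₀ (by linarith)]; linarith
  refine eq_two_of_cos_eq hk (h.time_ne_zero hreg hk0) hθ ?_
  -- The eigenvector takes the same value `k` at `u` and `v`, so `γ = 1` gives `cos (τ θ) = 1`.
  have := sum_mul_amplitude hreg hk0 u (fun z => if z = u ∨ z = v then (k : ℂ) else -1)
    (Real.arccos (-1 / k)) (by
      intro w
      rw [sum_neighborFinset_antipodal hreg h.1 huv hadj, hθ]
      push_cast
      field_simp) τ
  simp only [h', hγ, mul_ite, mul_one, mul_zero, Finset.sum_ite_eq', Finset.mem_univ, if_true,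
    or_true, true_or] at this
  have h2 := mul_right_cancel₀ hk' ((one_mul (k : ℂ)).trans this)
  exact_mod_cast h2.symm

/-! ### Graphs of degree two: recognising the hexagon, and transfer on it -/

theorem adj_iff_of_isRegularOfDegree_two (hreg : G.IsRegularOfDegree 2) {c p q : V}
    (hp : G.Adj c p) (hq : G.Adj c q) (hpq : p ≠ q) (w : V) : G.Adj c w ↔ w = p ∨ w = q := by
  have h : ({p, q} : Finset V) = G.neighborFinset c := by
    refine Finset.eq_of_subset_of_card_le ?_ ?_
    · intro z hz
      rcases Finset.mem_insert.1 hz with rfl | hz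
      · simpa using hp
      · rw [Finset.mem_singleton] at hz
        subst hz
        simpa using hq
    · rw [SimpleGraph.card_neighborFinset_eq_degree, hreg c, Finset.card_pair hpq]
  rw [← SimpleGraph.mem_neighborFinset, ← h]
  simp

theorem cycleGraph_six_adj_iff (i j : Fin 6) :
    (SimpleGraph.cycleGraph 6).Adj i j ↔ j = i + 1 ∨ j = i - 1 := by
  revert i j
  decide

/-- A graph of degree two with an antipodal pair `u`, `v` at distance three such that every other
vertex is adjacent to exactly one of the two is a hexagon. -/
theorem exists_iso_cycleGraph_six (hreg : G.IsRegularOfDegree 2) {u v : V} (huv : ¬ G.Adj u v)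
    (hne : u ≠ v) (hadj : ∀ w, w ≠ u → w ≠ v → (G.Adj w v ↔ ¬ G.Adj w u))
    (hex : ∀ w, G.Adj u w → ∃ x, G.Adj w x ∧ G.Adj x v) :
    Nonempty (G ≃g SimpleGraph.cycleGraph 6) := by
  have hu : (G.neighborFinset u).card = 2 := by
    rw [SimpleGraph.card_neighborFinset_eq_degree, hreg u]
  obtain ⟨a, b, hab, hN⟩ := Finset.card_eq_two.1 hu
  have hua : G.Adj u a := by rw [← SimpleGraph.mem_neighborFinset, hN]; simp
  have hub : G.Adj u b := by rw [← SimpleGraph.mem_neighborFinset, hN]; simp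
  obtain ⟨c, hac, hcv⟩ := hex a hua
  obtain ⟨d, hbd, hdv⟩ := hex b hub
  have hcu : c ≠ u := by rintro rfl; exact huv hcv
  have hdu : d ≠ u := by rintro rfl; exact huv hdv
  have hav : a ≠ v := by rintro rfl; exact huv hua
  have hbv : b ≠ v := by rintro rfl; exact huv hub
  have hnav : ¬ G.Adj a v := fun h => (hadj a hua.ne' hav).1 h hua.symm
  have hnbv : ¬ G.Adj b v := fun h => (hadj b hub.ne' hbv).1 h hub.symm
  have hca : c ≠ a := hac.ne'
  have hcb : c ≠ b := by rintro rfl; exact hnbv hcv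
  have hda : d ≠ a := by rintro rfl; exact hnav hdv
  have hdb : d ≠ b := hbd.ne'
  have hNc := adj_iff_of_isRegularOfDegree_two hreg hcv hac.symm hav.symm
  have hcd : c ≠ d := by
    rintro rfl
    rcases (hNc b).1 hbd.symm with h | h
    · exact hbv h
    · exact hab h.symm
  have hNu := adj_iff_of_isRegularOfDegree_two hreg hua hub hab
  have hNa := adj_iff_of_isRegularOfDegree_two hreg hac hua.symm hcu
  have hNv := adj_iff_of_isRegularOfDegree_two hreg hdv.symm hcv.symm hcd.symm
  have hNd := adj_iff_of_isRegularOfDegree_two hreg hbd.symm hdv hbv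
  have hNb := adj_iff_of_isRegularOfDegree_two hreg hub.symm hbd hdu.symm
  -- The six vertices in cyclic order, with `u` and `v` opposite.
  let f : Fin 6 → V := ![u, a, c, v, d, b]
  have hf : ∀ i w, G.Adj (f i) w ↔ w = f (i + 1) ∨ w = f (i - 1) := by
    intro i w
    fin_cases i
    exacts [hNu w, hNa w, hNc w, hNv w, hNd w, hNb w]
  have hinj : Function.Injective f := by
    have : (List.ofFn f).Nodup := by
      simp [f, hua.ne, hub.ne, hcu.symm, hdu.symm, hne, hca.symm, hcb, hav, hab, hda.symm, hcv.ne,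
        hcd, hdv.ne', hbv.symm, hdb]
    exact List.nodup_ofFn.1 this
  have hsurj : Function.Surjective f := by
    intro w
    by_cases h1 : w = u
    · exact ⟨0, h1.symm⟩
    by_cases h2 : w = v
    · exact ⟨3, h2.symm⟩
    by_cases h3 : G.Adj w u
    · rcases (hNu w).1 h3.symm with h | h
      exacts [⟨1, h.symm⟩, ⟨5, h.symm⟩]
    · rcases (hNv w).1 ((hadj w h1 h2).2 h3).symm with h | h
      exacts [⟨4, h.symm⟩, ⟨2, h.symm⟩]
  refine ⟨RelIso.symm ⟨Equiv.ofBijective f (show f.Bijective from ⟨hinj, hsurj⟩), ?_⟩⟩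
  intro i j
  change G.Adj (f i) (f j) ↔ _
  rw [hf, cycleGraph_six_adj_iff, hinj.eq_iff, hinj.eq_iff]

/-- On a graph of degree two the walk moves an arc straight ahead. -/
theorem evolution_mulVec_apply_of_degree_two (hreg : G.IsRegularOfDegree 2) {c p q : V}
    (hp : G.Adj c p) (hq : G.Adj c q) (hpq : p ≠ q) (x : G.Dart → ℂ) :
    (evolution G *ᵥ x) ⟨(c, p), hp⟩ = x ⟨(q, c), hq.symm⟩ := by
  have h : ({b : G.Dart | b.snd = c} : Finset G.Dart) =
      {⟨(p, c), hp.symm⟩, ⟨(q, c), hq.symm⟩} := by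
    ext ⟨⟨b1, b2⟩, hb⟩
    simp only [Finset.mem_filter, Finset.mem_univ, true_and, Finset.mem_insert,
      Finset.mem_singleton, SimpleGraph.Dart.mk.injEq, Prod.mk.injEq]
    constructor
    · rintro rfl
      simpa using (adj_iff_of_isRegularOfDegree_two hreg hp hq hpq b1).1 hb.symm
    · rintro (h | h) <;> exact h.2
  rw [evolution_mulVec_apply, hreg, h, Finset.sum_pair (by simp [hpq])]
  simp

theorem ExhibitsPST.of_iso_cycleGraph_six (e : G ≃g SimpleGraph.cycleGraph 6) :
    ExhibitsPST G := by
  have hadj : ∀ i j, G.Adj (e.symm i) (e.symm j) ↔ j = i + 1 ∨ j = i - 1 := fun i j => by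
    rw [e.symm.map_adj_iff, cycleGraph_six_adj_iff]
  have hreg : G.IsRegularOfDegree 2 := by
    intro w
    rw [← e.degree_eq w, SimpleGraph.cycleGraph_degree_three_le]
  have hinj : Function.Injective e.symm := e.symm.injective
  -- `r` and `l` list the arcs of the two orientations; each step rotates either family by one
  -- place.
  let r (i : Fin 6) : G.Dart := ⟨(e.symm i, e.symm (i + 1)), (hadj _ _).2 (.inl rfl)⟩
  let l (i : Fin 6) : G.Dart := ⟨(e.symm i, e.symm (i - 1)), (hadj _ _).2 (.inr rfl)⟩
  have hpm : ∀ i : Fin 6, i + 1 ≠ i - 1 := by decide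
  have h0r : ∀ i : Fin 6, i - 1 - 1 - 1 + 1 = 0 ↔ i + 1 = 3 := by decide
  have h0l : ∀ i : Fin 6, i + 1 + 1 + 1 - 1 = 0 ↔ i - 1 = 3 := by decide
  have hr : ∀ x i, (evolution G *ᵥ x) (r i) = x (r (i - 1)) := by
    intro x i
    rw [evolution_mulVec_apply_of_degree_two hreg (r i).adj (l i).adj (hinj.ne (hpm i))]
    congr 1
    exact SimpleGraph.Dart.ext _ _ (by simp [r, l])
  have hl : ∀ x i, (evolution G *ᵥ x) (l i) = x (l (i + 1)) := by
    intro x i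
    rw [evolution_mulVec_apply_of_degree_two hreg (l i).adj (r i).adj (hinj.ne (hpm i).symm)]
    congr 1
    exact SimpleGraph.Dart.ext _ _ (by simp [r, l])
  refine ⟨e.symm 0, e.symm 3, 3, hinj.ne (by decide), 1, by simp, ?_⟩
  rw [one_smul, pow_succ', pow_two, ← Matrix.mulVec_mulVec, ← Matrix.mulVec_mulVec]
  funext a
  obtain ⟨i, hi⟩ := e.symm.surjective a.fst
  obtain ⟨j, hj⟩ := e.symm.surjective a.snd
  have ha := a.adj
  rw [← hi, ← hj, hadj] at ha
  rcases ha with rfl | rfl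
  · obtain rfl : r i = a := SimpleGraph.Dart.ext _ _ (Prod.ext hi hj)
    rw [hr, hr, hr, vertexState_apply, vertexState_apply, hreg, hreg]
    simp only [r, hinj.eq_iff, h0r]
  · obtain rfl : l i = a := SimpleGraph.Dart.ext _ _ (Prod.ext hi hj)
    rw [hl, hl, hl, vertexState_apply, vertexState_apply, hreg, hreg]
    simp only [l, hinj.eq_iff, h0l]

end Forward

end GroverWalk

theorem theorem4p6 {V : Type*} [Fintype V] [DecidableEq V] (G : SimpleGraph V)
    [DecidableRel G.Adj] (hG : GroverWalk.IsDistanceRegular G) (hdiam : G.diam = 3) :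
    GroverWalk.ExhibitsPST G ↔ Nonempty (G ≃g SimpleGraph.cycleGraph 6) := by
  refine ⟨?_, fun ⟨e⟩ => .of_iso_cycleGraph_six e⟩
  rintro ⟨u, v, τ, h⟩
  obtain ⟨k, hreg⟩ := hG.isRegularOfDegree
  have := hG.1.nonempty
  obtain ⟨s, t, hst⟩ := G.exists_dist_eq_diam
  rw [hdiam] at hst
  have hle : ∀ x y, G.dist x y ≤ 3 := fun x y =>
    hdiam ▸ SimpleGraph.dist_le_diam (SimpleGraph.ediam_ne_top_of_diam_ne_zero (by omega))
  have hk := GroverWalk.two_le_degree hreg hst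
  have huv := hG.eq_of_pst hreg (by omega) h
  have hd := hG.dist_eq_three hle hst h.1 huv
  rw [hd] at huv
  have hadj : ∀ w, w ≠ u → w ≠ v → (G.Adj w v ↔ ¬ G.Adj w u) :=
    fun w => hG.adj_iff_not_adj hle hd huv
  have hnot : ¬ G.Adj u v := fun h => by
    rw [SimpleGraph.dist_eq_one_iff_adj.2 h] at hd
    omega
  obtain rfl := GroverWalk.degree_eq_two_of_pst_antipodal hreg hk h hnot hadj
  refine GroverWalk.exists_iso_cycleGraph_six hreg hnot h.1 hadj fun w huw => ?_
  -- Distance-regularity transports the rest of one geodesic to start at any neighbor `w` of `u`;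
  -- its end is at distance three from `u`, hence is `v`.
  obtain ⟨x, y, hux, hxy, hyv, h1, h2⟩ := GroverWalk.exists_geodesic_of_dist_eq_three hd
  obtain ⟨y', hy', hwy⟩ := hG.exists_adj
    (h1.trans (SimpleGraph.dist_eq_one_iff_adj.2 huw).symm) y h2 hxy
  obtain ⟨v', hv', hadj'⟩ := hG.exists_adj (h2.trans hy'.symm) v hd hyv
  exact ⟨y', hwy, huv v' hv' ▸ hadj'⟩
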